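/- For integers $N \ge 2$ and a set $D$ of divisors $d$ of $N$ with $1 \le d < N$, let $\mathrm{ICG}_N(D)$ be the integral circulant graph with vertex set $\mathbb{Z}/N\mathbb{Z}$ in which $j$ and $k$ are adjacent if and only if $k-j$ is the residue class of some integer $s$ with $1 \le s < N$ and $\gcd(N,s) \in D$. A finite simple graph $G$ with adjacency matrix $A_G$ has perfect state transfer from a vertex $a$ to a vertex $b$ at time $t \in \mathbb{R}$ if the $(b,a)$ entry of the matrix $e^{-itA_G}$ has absolute value $1$. Let $n = 2^u$ with $u \ge 3$ an integer. Then each of the graphs $\mathrm{ICG}_{2n}(\{1,2,n/2\})$ and $\mathrm{ICG}_{2n}(\{1,2,n\})$ has perfect state transfer from vertex $0$ to vertex $n$ at time $\pi/2$. -/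

import Mathlib

/-- The class of edge distances `{k : gcd (n, k) = d, 1 ≤ k < n}`, regarded inside `ℤ/nℤ`. -/
def gcdClass (n d : ℕ) : Set (ZMod n) :=
  {s | ∃ k : ℕ, 1 ≤ k ∧ k < n ∧ Nat.gcd n k = d ∧ (k : ZMod n) = s}

/-- The integral circulant graph with vertex set `ℤ/nℤ` in which the edge distances are the
residues `k` with `1 ≤ k < n` and `gcd (n, k) ∈ D`. This set of distances is closed under negation,
so the symmetrization built into `SimpleGraph.circulantGraph` adds nothing. -/
def ICG (n : ℕ) (D : Set ℕ) : SimpleGraph (ZMod n) :=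
  SimpleGraph.circulantGraph (⋃ d ∈ D, gcdClass n d)

open Classical in
/-- The operator `exp (-i t A)` of the continuous-time quantum walk on a finite graph with adjacency
matrix `A`. -/
noncomputable def quantumWalk {V : Type*} [Fintype V] [DecidableEq V]
    (G : SimpleGraph V) (t : ℝ) : Matrix V V ℂ :=
  NormedSpace.exp ((-(Complex.I * (t : ℂ))) • G.adjMatrix ℂ)

/-- Perfect state transfer from `a` to `b` at time `t`: the matrix entry `⟨b| exp (-i t A) |a⟩` has
modulus one. -/
def HasPerfectStateTransfer {V : Type*} [Fintype V] [DecidableEq V]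
    (G : SimpleGraph V) (a b : V) (t : ℝ) : Prop :=
  ‖quantumWalk G t b a‖ = 1

/-! Let `H_i` be the subgroup of `ZMod (2 ^ (u + 1))` generated by `2 ^ i`, and `J_i` its coset
matrix. The gcd class of `2 ^ j` is `H_j \ H_{j+1}`, so the adjacency matrix for `{1, 2, 2 ^ j}`
telescopes to `J_0 - J_2 + J_j - J_{j+1}`. These matrices commute and satisfy `J * J = |H| • J`, so
the walk is a product of explicit exponentials. At time `π/2` a factor is trivial if `4 ∣ |H|` and
equals `1 - J` if `|H| = 2`. For `j = u - 1` and `j = u` only `1 - J_u` survives, up to a phase, and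
its entry at `(2 ^ u, 0)` is `-1`. -/

/-- The exponential of a scalar multiple of a quasi-idempotent matrix. -/
theorem exp_smul_of_mul_self {V : Type*} [Fintype V] [DecidableEq V] (M : Matrix V V ℂ)
    (m : ℂ) (hm : m ≠ 0) (hM : M * M = m • M) (c : ℂ) :
    NormedSpace.exp (c • M) = 1 + ((Complex.exp (c * m) - 1) / m) • M := by
  let _ : NormedRing (Matrix V V ℂ) := Matrix.linftyOpNormedRing
  let _ : NormedAlgebra ℂ (Matrix V V ℂ) := Matrix.linftyOpNormedAlgebra
  let _ : NormedAlgebra ℚ (Matrix V V ℂ) := NormedAlgebra.restrictScalars ℚ ℂ _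
  have hpow : ∀ k : ℕ, M ^ (k + 1) = m ^ k • M := by
    intro k
    induction k with
    | zero => simp
    | succ k ih => rw [pow_succ, ih, smul_mul_assoc, hM, smul_smul, pow_succ]
  have h1 : HasSum (fun k : ℕ => ((Nat.factorial k : ℂ)⁻¹) • (c • M) ^ k)
      (NormedSpace.exp (c • M)) :=
    NormedSpace.exp_series_hasSum_exp' (𝕂 := ℂ) (c • M)
  have h2 : HasSum (fun k : ℕ => ((Nat.factorial k : ℂ)⁻¹) • (c * m) ^ k)
      (Complex.exp (c * m)) := by
    rw [Complex.exp_eq_exp_ℂ]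
    exact NormedSpace.exp_series_hasSum_exp' (𝕂 := ℂ) (c * m)
  -- The term of index 0 is split off because `M ^ 0` is not a multiple of `M`.
  have h1' := (hasSum_nat_add_iff' 1).mpr h1
  have h2' := (((hasSum_nat_add_iff' 1).mpr h2).div_const m).smul_const M
  simp only [Finset.range_one, Finset.sum_singleton, Nat.factorial_zero, Nat.cast_one, inv_one,
    pow_zero, one_smul] at h1' h2'
  rw [← sub_eq_iff_eq_add']
  refine h1'.unique (h2'.congr_fun ?_)
  intro k
  rw [smul_pow, hpow, smul_smul, smul_smul, smul_eq_mul, mul_pow]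
  congr 1
  field_simp
  ring

/-! ### Coset matrices and their exponentials -/

open Classical in
/-- The matrix whose `(i, j)` entry indicates whether `i - j` lies in the subgroup `H`. -/
noncomputable def cosetMatrix {G : Type*} [AddCommGroup G] (H : AddSubgroup G) : Matrix G G ℂ :=
  Matrix.circulant fun x => if x ∈ H then 1 else 0

theorem cosetMatrix_apply_of_mem {G : Type*} [AddCommGroup G] {H : AddSubgroup G} {i j : G}
    (h : i - j ∈ H) : cosetMatrix H i j = 1 := by
  simp [cosetMatrix, h]

theorem cosetMatrix_apply_of_notMem {G : Type*} [AddCommGroup G] {H : AddSubgroup G} {i j : G}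
    (h : i - j ∉ H) : cosetMatrix H i j = 0 := by
  simp [cosetMatrix, h]

section

variable {G : Type*} [AddCommGroup G] [Fintype G]

theorem commute_cosetMatrix (H K : AddSubgroup G) :
    Commute (cosetMatrix H) (cosetMatrix K) :=
  Matrix.circulant_mul_comm _ _

/-- The `(i, j)` entry counts the `k` in both cosets `i + H` and `j + H`, which coincide or are
disjoint. -/
theorem cosetMatrix_mul_self (H : AddSubgroup G) :
    cosetMatrix H * cosetMatrix H = (Nat.card H : ℂ) • cosetMatrix H := by
  classical
  ext i j
  rw [Matrix.mul_apply, Matrix.smul_apply]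
  by_cases hij : i - j ∈ H
  · have h : ∀ k, cosetMatrix H i k * cosetMatrix H k j = if i - k ∈ H then 1 else 0 := by
      intro k
      by_cases hk : i - k ∈ H
      · have hkj : k - j ∈ H := by simpa using H.sub_mem hij hk
        simp [cosetMatrix_apply_of_mem, hk, hkj]
      · simp [cosetMatrix_apply_of_notMem, hk]
    have hsum : ∑ k, (if i - k ∈ H then (1 : ℂ) else 0) = ∑ x, if x ∈ H then (1 : ℂ) else 0 :=
      (Equiv.subLeft i).sum_comp fun x => if x ∈ H then (1 : ℂ) else 0
    rw [cosetMatrix_apply_of_mem hij, Finset.sum_congr rfl fun k _ => h k, hsum,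
      Finset.sum_boole, Nat.card_eq_fintype_card, Fintype.card_subtype]
    simp
  · rw [cosetMatrix_apply_of_notMem hij, smul_zero]
    refine Finset.sum_eq_zero fun k _ => ?_
    by_cases hk : i - k ∈ H
    · have hkj : k - j ∉ H := fun h => hij (by simpa using H.add_mem hk h)
      rw [cosetMatrix_apply_of_notMem hkj, mul_zero]
    · rw [cosetMatrix_apply_of_notMem hk, zero_mul]

variable [DecidableEq G]

theorem exp_smul_cosetMatrix (H : AddSubgroup G) (c : ℂ) :
    NormedSpace.exp (c • cosetMatrix H) =
      1 + ((Complex.exp (c * Nat.card H) - 1) / Nat.card H) • cosetMatrix H :=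
  exp_smul_of_mul_self _ _ (Nat.cast_ne_zero.mpr Nat.card_pos.ne') (cosetMatrix_mul_self H) c

theorem exp_smul_cosetMatrix_of_four_dvd_card (H : AddSubgroup G) (h : 4 ∣ Nat.card H) (z : ℤ) :
    NormedSpace.exp ((z * (Complex.I * ((Real.pi / 2 : ℝ) : ℂ))) • cosetMatrix H) = 1 := by
  obtain ⟨m, hm⟩ := h
  have : Complex.exp ((z * (Complex.I * ((Real.pi / 2 : ℝ) : ℂ))) * Nat.card H) = 1 := by
    rw [Complex.exp_eq_one_iff]
    refine ⟨z * m, ?_⟩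
    rw [hm]
    push_cast
    ring
  rw [exp_smul_cosetMatrix, this]
  simp

/-- Here `exp (z * π * I) = -1`, so the coefficient of the coset matrix is `(-1 - 1) / 2`. -/
theorem exp_smul_cosetMatrix_of_card_eq_two (H : AddSubgroup G) (h : Nat.card H = 2) {z : ℤ}
    (hz : Odd z) :
    NormedSpace.exp ((z * (Complex.I * ((Real.pi / 2 : ℝ) : ℂ))) • cosetMatrix H) =
      1 - cosetMatrix H := by
  obtain ⟨k, rfl⟩ := hz
  have : Complex.exp ((((2 * k + 1 : ℤ) : ℂ) * (Complex.I * ((Real.pi / 2 : ℝ) : ℂ))) *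
      (2 : ℕ)) = -1 := by
    have e : (((2 * k + 1 : ℤ) : ℂ) * (Complex.I * ((Real.pi / 2 : ℝ) : ℂ))) * (2 : ℕ) =
        Real.pi * Complex.I + k * (2 * Real.pi * Complex.I) := by
      push_cast
      ring
    rw [e, Complex.exp_add, Complex.exp_pi_mul_I, Complex.exp_int_mul_two_pi_mul_I, mul_one]
  rw [exp_smul_cosetMatrix, h, this]
  norm_num [sub_eq_add_neg]

end

/-! ### Gcd classes as differences of subgroups -/

theorem natCast_mem_zmultiples_iff {N d : ℕ} (hd : d ∣ N) (k : ℕ) :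
    (k : ZMod N) ∈ AddSubgroup.zmultiples (d : ZMod N) ↔ d ∣ k := by
  rw [AddSubgroup.mem_zmultiples_iff]
  constructor
  · rintro ⟨z, hz⟩
    have h : ((z * d : ℤ) : ZMod N) = ((k : ℤ) : ZMod N) := by
      push_cast
      simpa using hz
    rw [ZMod.intCast_eq_intCast_iff_dvd_sub] at h
    have h' : (d : ℤ) ∣ k - z * d := (Int.natCast_dvd_natCast.mpr hd).trans h
    exact Int.natCast_dvd_natCast.mp ((dvd_sub_left (Dvd.intro_left z rfl)).mp h')
  · rintro ⟨m, rfl⟩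
    exact ⟨m, by push_cast; rw [natCast_zsmul, nsmul_eq_mul, mul_comm]⟩

theorem natCard_zmultiples_natCast {N d : ℕ} [NeZero N] (hd : d ∣ N) :
    Nat.card (AddSubgroup.zmultiples (d : ZMod N)) = N / d := by
  rw [Nat.card_zmultiples, ZMod.addOrderOf_coe _ (NeZero.ne N), Nat.gcd_eq_right hd]

theorem gcd_two_pow_eq_two_pow_iff {m j : ℕ} (hj : j < m) (k : ℕ) :
    Nat.gcd (2 ^ m) k = 2 ^ j ↔ 2 ^ j ∣ k ∧ ¬ 2 ^ (j + 1) ∣ k := by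
  constructor
  · intro h
    refine ⟨h ▸ Nat.gcd_dvd_right _ _, fun h' => ?_⟩
    have := Nat.dvd_gcd (pow_dvd_pow 2 hj) h'
    rw [h, Nat.pow_dvd_pow_iff_le_right (by norm_num)] at this
    omega
  · rintro ⟨h1, h2⟩
    obtain ⟨i, hi, hi'⟩ := (Nat.dvd_prime_pow Nat.prime_two).mp (Nat.gcd_dvd_left (2 ^ m) k)
    have h3 := Nat.dvd_gcd (pow_dvd_pow 2 hj.le) h1
    rw [hi', Nat.pow_dvd_pow_iff_le_right (by norm_num)] at h3
    have h4 : ¬ j + 1 ≤ i := fun h =>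
      h2 ((pow_dvd_pow 2 h).trans (hi' ▸ Nat.gcd_dvd_right (2 ^ m) k))
    rw [hi', show i = j by omega]

theorem mem_gcdClass_two_pow_iff {m j : ℕ} (hj : j < m) (x : ZMod (2 ^ m)) :
    x ∈ gcdClass (2 ^ m) (2 ^ j) ↔
      x ∈ AddSubgroup.zmultiples ((2 ^ j : ℕ) : ZMod (2 ^ m)) ∧
        x ∉ AddSubgroup.zmultiples ((2 ^ (j + 1) : ℕ) : ZMod (2 ^ m)) := by
  have key (k : ℕ) : (k : ZMod (2 ^ m)) ∈ AddSubgroup.zmultiples ((2 ^ j : ℕ) : ZMod (2 ^ m)) ∧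
      (k : ZMod (2 ^ m)) ∉ AddSubgroup.zmultiples ((2 ^ (j + 1) : ℕ) : ZMod (2 ^ m)) ↔
      Nat.gcd (2 ^ m) k = 2 ^ j := by
    rw [natCast_mem_zmultiples_iff (pow_dvd_pow 2 hj.le),
      natCast_mem_zmultiples_iff (pow_dvd_pow 2 hj), gcd_two_pow_eq_two_pow_iff hj]
  constructor
  · rintro ⟨k, -, -, hk, rfl⟩
    exact (key k).mpr hk
  · intro h
    have hx : ((x.val : ℕ) : ZMod (2 ^ m)) = x := ZMod.natCast_zmod_val x
    have hg := (key x.val).mp (hx.symm ▸ h)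
    -- The bound `1 ≤ k` is automatic: 0 lies in the smaller subgroup.
    refine ⟨x.val, Nat.one_le_iff_ne_zero.mpr fun h0 => h.2 ?_, x.val_lt, hg, hx⟩
    rw [(ZMod.val_eq_zero x).mp h0]
    exact zero_mem _

theorem ICG_two_pow_adj_iff {m : ℕ} (S : Set ℕ) (hS : ∀ j ∈ S, j < m) (a b : ZMod (2 ^ m)) :
    (ICG (2 ^ m) ((fun j => 2 ^ j) '' S)).Adj a b ↔
      ∃ j ∈ S, a - b ∈ AddSubgroup.zmultiples ((2 ^ j : ℕ) : ZMod (2 ^ m)) ∧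
        a - b ∉ AddSubgroup.zmultiples ((2 ^ (j + 1) : ℕ) : ZMod (2 ^ m)) := by
  have hmem (x : ZMod (2 ^ m)) : x ∈ (⋃ d ∈ (fun j => 2 ^ j) '' S, gcdClass (2 ^ m) d) ↔
      ∃ j ∈ S, x ∈ AddSubgroup.zmultiples ((2 ^ j : ℕ) : ZMod (2 ^ m)) ∧
        x ∉ AddSubgroup.zmultiples ((2 ^ (j + 1) : ℕ) : ZMod (2 ^ m)) := by
    rw [Set.biUnion_image, Set.mem_iUnion₂]
    simp only [exists_prop]
    exact exists_congr fun j => and_congr_right fun hj => mem_gcdClass_two_pow_iff (hS j hj) x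
  have hneg : b - a = -(a - b) := (neg_sub a b).symm
  rw [ICG, SimpleGraph.circulantGraph, SimpleGraph.fromRel_adj, hmem, hmem, hneg]
  simp only [neg_mem_iff, or_self]
  refine and_iff_right_of_imp ?_
  rintro ⟨j, -, -, h⟩ rfl
  exact h (by simp)

theorem zmultiples_two_pow_anti {N i j : ℕ} (h : i ≤ j) :
    AddSubgroup.zmultiples ((2 ^ j : ℕ) : ZMod N) ≤
      AddSubgroup.zmultiples ((2 ^ i : ℕ) : ZMod N) := by
  rw [AddSubgroup.zmultiples_le, AddSubgroup.mem_zmultiples_iff]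
  refine ⟨2 ^ (j - i), ?_⟩
  rw [zsmul_eq_mul]
  push_cast
  rw [← pow_add, Nat.sub_add_cancel h]

/-! ### The walk at time `π/2` -/

open Classical in
theorem adjMatrix_ICG_two_pow {u j : ℕ} (h2j : 2 ≤ j) (hju : j ≤ u) :
    (ICG (2 ^ (u + 1)) ((fun j => 2 ^ j) '' {0, 1, j})).adjMatrix ℂ =
      (cosetMatrix (AddSubgroup.zmultiples ((2 ^ 0 : ℕ) : ZMod (2 ^ (u + 1)))) -
        cosetMatrix (AddSubgroup.zmultiples ((2 ^ 2 : ℕ) : ZMod (2 ^ (u + 1))))) +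
      (cosetMatrix (AddSubgroup.zmultiples ((2 ^ j : ℕ) : ZMod (2 ^ (u + 1)))) -
        cosetMatrix (AddSubgroup.zmultiples ((2 ^ (j + 1) : ℕ) : ZMod (2 ^ (u + 1))))) := by
  have indicator_eq (p0 p1 p2 p3 p4 q : Prop)
      (hq : q ↔ p0 ∧ ¬ p1 ∨ p1 ∧ ¬ p2 ∨ p3 ∧ ¬ p4) (h1 : p1 → p0) (h2 : p2 → p1) (h3 : p3 → p2)
      (h4 : p4 → p3) : (if q then (1 : ℂ) else 0) =
        ((if p0 then 1 else 0) - if p2 then 1 else 0) +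
          ((if p3 then 1 else 0) - if p4 then 1 else 0) := by
    by_cases p1 <;> by_cases p2 <;> by_cases p3 <;> by_cases p4 <;> by_cases p0 <;> simp_all
  ext a b
  have hadj := ICG_two_pow_adj_iff (m := u + 1) {0, 1, j}
    (by simp only [Set.mem_insert_iff, Set.mem_singleton_iff]; omega) a b
  simp only [Set.mem_insert_iff, Set.mem_singleton_iff, exists_eq_or_imp, exists_eq_left,
    Nat.zero_add, Nat.reduceAdd] at hadj
  simp only [SimpleGraph.adjMatrix_apply, Matrix.add_apply, Matrix.sub_apply, cosetMatrix,
    Matrix.circulant_apply]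
  exact indicator_eq _ _ _ _ _ _ hadj (@zmultiples_two_pow_anti _ 0 1 (by omega) _)
    (@zmultiples_two_pow_anti _ 1 2 (by omega) _) (@zmultiples_two_pow_anti _ 2 j h2j _)
    (@zmultiples_two_pow_anti _ j (j + 1) (by omega) _)

theorem natCard_zmultiples_two_pow {m j : ℕ} (hj : j ≤ m) :
    Nat.card (AddSubgroup.zmultiples ((2 ^ j : ℕ) : ZMod (2 ^ m))) = 2 ^ (m - j) := by
  rw [natCard_zmultiples_natCast (pow_dvd_pow 2 hj), Nat.pow_div hj (by norm_num)]

theorem quantumWalk_ICG_two_pow {u j : ℕ} (hu : 3 ≤ u) (h2j : 2 ≤ j) (hju : j ≤ u) :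
    quantumWalk (ICG (2 ^ (u + 1)) ((fun j => 2 ^ j) '' {0, 1, j})) (Real.pi / 2) =
      NormedSpace.exp ((((-1 : ℤ) : ℂ) * (Complex.I * ((Real.pi / 2 : ℝ) : ℂ))) •
        cosetMatrix (AddSubgroup.zmultiples ((2 ^ j : ℕ) : ZMod (2 ^ (u + 1))))) *
      NormedSpace.exp ((((1 : ℤ) : ℂ) * (Complex.I * ((Real.pi / 2 : ℝ) : ℂ))) •
        cosetMatrix (AddSubgroup.zmultiples ((2 ^ (j + 1) : ℕ) : ZMod (2 ^ (u + 1))))) := by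
  have hcomm (H K : AddSubgroup (ZMod (2 ^ (u + 1)))) (z w : ℂ) :
      Commute (z • cosetMatrix H) (w • cosetMatrix K) :=
    ((commute_cosetMatrix H K).smul_left z).smul_right w
  have hdvd (i : ℕ) (hi : i ≤ 2) :
      4 ∣ Nat.card (AddSubgroup.zmultiples ((2 ^ i : ℕ) : ZMod (2 ^ (u + 1)))) := by
    rw [natCard_zmultiples_two_pow (by omega)]
    -- For `i = 2` this is exactly where `3 ≤ u` is needed.
    exact pow_dvd_pow 2 (show 2 ≤ u + 1 - i by omega)
  rw [quantumWalk, adjMatrix_ICG_two_pow h2j hju]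
  have hsplit (c : ℂ) (A B C D : Matrix (ZMod (2 ^ (u + 1))) (ZMod (2 ^ (u + 1))) ℂ) :
      (-c) • (A - B + (C - D)) = (((-1 : ℤ) : ℂ) * c) • A + ((((1 : ℤ) : ℂ) * c) • B +
        ((((-1 : ℤ) : ℂ) * c) • C + (((1 : ℤ) : ℂ) * c) • D)) := by
    push_cast
    module
  rw [hsplit, Matrix.exp_add_of_commute _ _ ((hcomm _ _ _ _).add_right
      ((hcomm _ _ _ _).add_right (hcomm _ _ _ _))),
    Matrix.exp_add_of_commute _ _ ((hcomm _ _ _ _).add_right (hcomm _ _ _ _)),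
    Matrix.exp_add_of_commute _ _ (hcomm _ _ _ _),
    exp_smul_cosetMatrix_of_four_dvd_card _ (hdvd 0 (by omega)),
    exp_smul_cosetMatrix_of_four_dvd_card _ (hdvd 2 le_rfl), one_mul, one_mul]

theorem one_sub_cosetMatrix_apply_two_pow (u : ℕ) :
    ((1 : Matrix (ZMod (2 ^ (u + 1))) (ZMod (2 ^ (u + 1))) ℂ) -
      cosetMatrix (AddSubgroup.zmultiples ((2 ^ u : ℕ) : ZMod (2 ^ (u + 1)))))
        ((2 ^ u : ℕ) : ZMod (2 ^ (u + 1))) 0 = -1 := by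
  have hne : ((2 ^ u : ℕ) : ZMod (2 ^ (u + 1))) ≠ 0 := by
    rw [Ne, ZMod.natCast_eq_zero_iff, Nat.pow_dvd_pow_iff_le_right (by norm_num)]
    omega
  rw [Matrix.sub_apply, Matrix.one_apply_ne hne, cosetMatrix_apply_of_mem, zero_sub]
  rw [sub_zero]
  exact AddSubgroup.mem_zmultiples _

theorem hasPerfectStateTransfer_ICG_two_pow {u j : ℕ} (hu : 3 ≤ u) (hj : j = u - 1 ∨ j = u)
    {N : ℕ} [NeZero N] (hN : N = 2 ^ (u + 1)) :
    HasPerfectStateTransfer (ICG N ((fun j => 2 ^ j) '' {0, 1, j})) (0 : ZMod N)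
      ((2 ^ u : ℕ) : ZMod N) (Real.pi / 2) := by
  subst hN
  rw [HasPerfectStateTransfer, quantumWalk_ICG_two_pow hu (by omega) (by omega)]
  have hcard : Nat.card (AddSubgroup.zmultiples ((2 ^ u : ℕ) : ZMod (2 ^ (u + 1)))) = 2 := by
    rw [natCard_zmultiples_two_pow (by omega), Nat.add_sub_cancel_left, pow_one]
  obtain rfl | rfl := hj
  · have h4 : 4 ∣ Nat.card
        (AddSubgroup.zmultiples ((2 ^ (u - 1) : ℕ) : ZMod (2 ^ (u + 1)))) := by
      rw [natCard_zmultiples_two_pow (by omega)]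
      exact pow_dvd_pow 2 (show 2 ≤ u + 1 - (u - 1) by omega)
    rw [exp_smul_cosetMatrix_of_four_dvd_card _ h4, one_mul, Nat.sub_add_cancel (by omega),
      exp_smul_cosetMatrix_of_card_eq_two _ hcard odd_one, one_sub_cosetMatrix_apply_two_pow]
    simp
  -- `H_{j+1}` is now trivial, so its factor is the scalar `exp (I * π / 2)`, of modulus one.
  · have hbot : AddSubgroup.zmultiples ((2 ^ (j + 1) : ℕ) : ZMod (2 ^ (j + 1))) = ⊥ := by
      rw [ZMod.natCast_self, AddSubgroup.zmultiples_zero_eq_bot]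
    have hone : cosetMatrix (⊥ : AddSubgroup (ZMod (2 ^ (j + 1)))) = 1 := by
      ext a b
      simp [cosetMatrix, Matrix.one_apply, sub_eq_zero]
    have hexp (c : ℂ) : NormedSpace.exp
        (c • cosetMatrix (⊥ : AddSubgroup (ZMod (2 ^ (j + 1))))) = Complex.exp c • 1 := by
      rw [exp_smul_cosetMatrix, hone, AddSubgroup.card_bot, Nat.cast_one, mul_one, div_one,
        sub_smul, one_smul, add_sub_cancel]
    rw [exp_smul_cosetMatrix_of_card_eq_two _ hcard (by decide), hbot, hexp, mul_smul_comm,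
      mul_one, Matrix.smul_apply, one_sub_cosetMatrix_apply_two_pow, norm_smul, norm_neg,
      norm_one, mul_one, Int.cast_one, one_mul, mul_comm, Complex.norm_exp_ofReal_mul_I]

theorem mainTheorem9 (u : ℕ) (hu : 3 ≤ u) :
    HasPerfectStateTransfer (ICG (2 * 2 ^ u) {1, 2, 2 ^ u / 2})
        (0 : ZMod (2 * 2 ^ u)) ((2 ^ u : ℕ) : ZMod (2 * 2 ^ u)) (Real.pi / 2) ∧
      HasPerfectStateTransfer (ICG (2 * 2 ^ u) {1, 2, 2 ^ u})
        (0 : ZMod (2 * 2 ^ u)) ((2 ^ u : ℕ) : ZMod (2 * 2 ^ u)) (Real.pi / 2) := by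
  have hN : 2 * 2 ^ u = 2 ^ (u + 1) := (pow_succ' 2 u).symm
  have hhalf : 2 ^ u / 2 = 2 ^ (u - 1) := by
    simpa using Nat.pow_div (show 1 ≤ u by omega) (show 0 < 2 by norm_num)
  constructor
  · have h := hasPerfectStateTransfer_ICG_two_pow hu (Or.inl rfl) hN
    simpa only [Set.image_insert_eq, Set.image_singleton, pow_zero, pow_one, ← hhalf] using h
  · have h := hasPerfectStateTransfer_ICG_two_pow hu (Or.inr rfl) hN
    simpa only [Set.image_insert_eq, Set.image_singleton, pow_zero, pow_one] using h
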